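/- A Markov decision process (MDP) consists of a countable set $S$ of states, partitioned into controlled and random states, a transition relation $\to$ on $S$ in which every state has a successor, for each random state a probability distribution over its successors, and a reward function $r:S\times S\to\mathbb{R}$. A strategy $\sigma$ assigns to every finite path ending in a controlled state $s$ a probability distribution over the successors of $s$; together with an initial state $s_0$ it induces a probability measure $\mathcal{P}_{s_0,\sigma}$ on runs. Let $MP$ be the set of runs $\rho_0\rho_1\cdots$ with $\liminf_{n\to\infty}\frac1n\sum_{j=0}^{n-1} r(\rho_j,\rho_{j+1})\ge 0$ (in the extended reals), let the value of $s_0$ be $\sup_\sigma \mathcal{P}_{s_0,\sigma}(MP)$ over all strategies, and call $\sigma$ $\varepsilon$-optimal from $s_0$ if $\mathcal{P}_{s_0,\sigma}(MP)$ is at least this value minus $\varepsilon$. A memory with countable set $\mathsf{M}$ of modes is a map $\tau$ assigning to each $(m,s)\in\mathsf{M}\times S$ a probability distribution on $\mathsf{M}\times S$, supported on $\mathsf{M}\times\{s'\mid s\to s'\}$ if $s$ is controlled, and with $S$-marginal equal to the distribution given by the MDP at $s$ if $s$ is random. The strategy induced by $\tau$ from an initial mode $m_0$ and initial state $s_0$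 plays, after a history $h=s_0\cdots s_n$ with $s_n$ controlled that has positive probability in the Markov chain $\tau$ started in $(m_0,s_0)$, the state $s'$ with probability $\sum_{m,m'}\mu_h(m)\,\tau(m,s_n)(m',s')$, where $\mu_h$ is the distribution of the mode of that chain after $n$ steps conditioned on its state sequence being $h$. A finite-memory randomized strategy from $s_0$ is one induced in this way with $\mathsf{M}$ finite. A $k$-bit Markov strategy from $s_0$ is one induced with $\mathsf{M}=\mathbb{N}\times\{0,1\}^k$, where the first component is a step counter: it starts with $0$ and is incremented by $1$ in every step. **Theorem.** There exist a countable, finitely branching, acyclic MDP and a state $s_0$ of it such that 1. the step counter is implicit in the state: for every state $s$ there is $n_s\in\mathbb{N}$ such that every path from $s_0$ to $s$ has length $n_s$; 2. the value of $s_0$ for $MP$ is $1$; 3. every finite-memory randomized strategy $\sigma$ from $s_0$ satisfies $\mathcal{P}_{s_0,\sigma}(MP)=0$; 4. for every $k\in\mathbb{N}$ and every $\varepsilon<1$, there is no $k$-bit Markov strategy that is $\varepsilon$-optimal for $MP$ from $s_0$ in this MDP. -/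

import Mathlib

open MeasureTheory ProbabilityTheory Filter

/-- A Markov decision process with state set `S` and real transition rewards. The states in
`controlled` are the controlled states, all others are random states. Every state has a successor,
and every random state carries a probability distribution over its successors. -/
structure MDP (S : Type*) where
  controlled : Set S
  trans : S → S → Prop
  exists_succ : ∀ s, ∃ s', trans s s'
  prob : ∀ s, s ∉ controlled → PMF S
  prob_support : ∀ s (hs : s ∉ controlled), ∀ s' ∈ (prob s hs).support, trans s s'
  reward : S → S → ℝ

/-- Finite sequences `x_0 ... x_n`. -/
abbrev Hist (X : Type*) (n : ℕ) : Type _ := Finset.Iic n → X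

/-- The last element `x_n` of `x_0 ... x_n`. -/
def Hist.last {X : Type*} {n : ℕ} (h : Hist X n) : X := h ⟨n, Finset.mem_Iic.2 le_rfl⟩

section PathMeasure

variable {X : Type*} [Countable X] [MeasurableSpace X] [DiscreteMeasurableSpace X]

/-- A rule giving the distribution of the next element from the history, as a kernel. -/
noncomputable def stepKernel (f : ∀ n, Hist X n → PMF X) (n : ℕ) : Kernel (Hist X n) X where
  toFun h := (f n h).toMeasure
  measurable' := measurable_of_countable _

instance stepKernel.instIsMarkovKernel (f : ∀ n, Hist X n → PMF X) (n : ℕ) :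
    IsMarkovKernel (stepKernel f n) :=
  ⟨fun h => PMF.toMeasure.isProbabilityMeasure (f n h)⟩

/-- The law (Ionescu-Tulcea) of the infinite sequence that starts in `x₀` and whose element with
index `n + 1` is drawn from `f n (x_0 ... x_n)`: the cylinder of `x_0 ... x_n` with `x_0 = x₀`
has measure `∏ i < n, f i (x_0 ... x_i) x_{i+1}`. -/
noncomputable def pathMeasure (f : ∀ n, Hist X n → PMF X) (x₀ : X) : Measure (ℕ → X) :=
  Kernel.traj (X := fun _ => X) (stepKernel f) 0 (fun _ => x₀)

end PathMeasure

namespace MDP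

variable {S : Type*}

/-- No directed cycle. -/
def Acyclic (M : MDP S) : Prop := ∀ s, ¬ Relation.TransGen M.trans s s

def FinitelyBranching (M : MDP S) : Prop := ∀ s, {s' | M.trans s s'}.Finite

/-- There is a path with exactly `n` transitions from `s` to `t`. -/
def HasPath (M : MDP S) (n : ℕ) (s t : S) : Prop :=
  ∃ p : ℕ → S, p 0 = s ∧ p n = t ∧ ∀ i < n, M.trans (p i) (p (i + 1))

/-- The step counter is implicit in the state: all paths from `s₀` to a given state have
the same length. -/
def StepCounterImplicit (M : MDP S) (s₀ : S) : Prop :=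
  ∀ s, ∃ ns : ℕ, ∀ n, M.HasPath n s₀ s → n = ns

/-- A (history dependent, randomized) strategy assigns to every history that ends in a controlled
state a distribution over the successors of that state. Histories that are not paths
are allowed as arguments; they have probability zero. -/
structure Strategy (M : MDP S) where
  act : ∀ (n : ℕ) (h : Hist S n), h.last ∈ M.controlled → PMF S
  act_support : ∀ n (h : Hist S n) (hc : h.last ∈ M.controlled),
    ∀ s' ∈ (act n h hc).support, M.trans h.last s'

open Classical in
/-- The distribution of the next state: chosen by the strategy in controlled states,
and by the MDP in random states. -/
noncomputable def Strategy.next {M : MDP S} (σ : M.Strategy) (n : ℕ) (h : Hist S n) : PMF S :=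
  if hc : h.last ∈ M.controlled then σ.act n h hc else M.prob h.last hc

/-- The mean payoff objective: the limit inferior, in the extended reals, of the
average transition reward is nonnegative. (State sequences that are not runs have
probability zero under every strategy.) -/
def MP (M : MDP S) : Set (ℕ → S) :=
  {ρ | 0 ≤ liminf (fun n : ℕ =>
    (((1 / (n : ℝ)) * ∑ j ∈ Finset.range n, M.reward (ρ j) (ρ (j + 1)) : ℝ) : EReal)) atTop}

section Probability

variable [Countable S] [MeasurableSpace S] [DiscreteMeasurableSpace S]

/-- The probability measure on runs induced by the initial state and the strategy. -/
noncomputable def runMeasure (M : MDP S) (s₀ : S) (σ : M.Strategy) : Measure (ℕ → S) :=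
  pathMeasure σ.next s₀

/-- The value of a state: the supremum over all strategies of the probability of the objective. -/
noncomputable def value (M : MDP S) (φ : Set (ℕ → S)) (s₀ : S) : ENNReal :=
  ⨆ σ : M.Strategy, M.runMeasure s₀ σ φ

def IsEpsOptimal (M : MDP S) (φ : Set (ℕ → S)) (s₀ : S) (ε : ℝ) (σ : M.Strategy) : Prop :=
  (M.value φ s₀).toReal - ε ≤ (M.runMeasure s₀ σ φ).toReal

end Probability

/-- A randomized memory update function `τ` for the set `Mem` of memory modes. In
controlled states it chooses the new mode and the successor state jointly; in random states
the successor state is distributed as the MDP prescribes. -/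
structure MemoryUpdate (M : MDP S) (Mem : Type*) where
  next : Mem × S → PMF (Mem × S)
  next_controlled : ∀ m, ∀ s ∈ M.controlled, ∀ p ∈ (next (m, s)).support, M.trans s p.2
  next_random : ∀ m s (hs : s ∉ M.controlled) (s' : S),
    ∑' m', next (m, s) (m', s') = M.prob s hs s'

section Memory

variable [Countable S] [MeasurableSpace S] [DiscreteMeasurableSpace S]
variable {Mem : Type*} [Countable Mem] [MeasurableSpace Mem] [DiscreteMeasurableSpace Mem]

/-- The law of the Markov chain on `Mem × S` with transition function `τ`, from `(m₀, s₀)`. -/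
noncomputable def MemoryUpdate.chain {M : MDP S} (τ : M.MemoryUpdate Mem) (m₀ : Mem) (s₀ : S) :
    Measure (ℕ → Mem × S) :=
  pathMeasure (fun _ h => τ.next h.last) (m₀, s₀)

/-- The event that the Markov chain follows the state sequence `h` (with any memory modes). -/
def follows (Mem : Type*) {n : ℕ} (h : Hist S n) : Set (ℕ → Mem × S) :=
  {w | ∀ i : Finset.Iic n, (w i).2 = h i}

/-- The probability of being in mode `m` after the state sequence `h`, conditioned on `h`. -/
noncomputable def MemoryUpdate.modeProb {M : MDP S} (τ : M.MemoryUpdate Mem) (m₀ : Mem) (s₀ : S)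
    {n : ℕ} (h : Hist S n) (m : Mem) : ENNReal :=
  (cond (τ.chain m₀ s₀) (follows Mem h)) {w | (w n).1 = m}

/-- From the initial state `s₀`, the strategy `σ` is the one induced by `τ` and the
initial mode `m₀`. Histories of probability zero, where the conditional
distribution over modes is undefined, are not constrained. -/
def MemoryUpdate.Implements {M : MDP S} (τ : M.MemoryUpdate Mem) (m₀ : Mem) (s₀ : S)
    (σ : M.Strategy) : Prop :=
  ∀ (n : ℕ) (h : Hist S n) (hc : h.last ∈ M.controlled), τ.chain m₀ s₀ (follows Mem h) ≠ 0 →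
    ∀ s', σ.act n h hc s' =
      ∑' (m : Mem) (m' : Mem), τ.modeProb m₀ s₀ h m * τ.next (m, h.last) (m', s')

/-- Finite memory randomized (FR) strategies. -/
def IsFR (M : MDP S) (s₀ : S) (σ : M.Strategy) : Prop :=
  ∃ (Mem : Type) (_ : Finite Mem) (_ : MeasurableSpace Mem) (_ : DiscreteMeasurableSpace Mem)
    (τ : M.MemoryUpdate Mem) (m₀ : Mem), τ.Implements m₀ s₀ σ

/-- `k`-bit Markov strategies: the memory consists of a step counter, which starts with `0` and
is incremented in every step, and of `k` bits of general purpose memory. -/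
def IsKBitMarkov (M : MDP S) (s₀ : S) (k : ℕ) (σ : M.Strategy) : Prop :=
  ∃ (τ : M.MemoryUpdate (ℕ × (Fin k → Bool))) (b₀ : Fin k → Bool),
    (∀ m s, ∀ p ∈ (τ.next (m, s)).support, p.1.1 = m.1 + 1) ∧ τ.Implements (0, b₀) s₀ σ

end Memory

end MDP

/-! The MDP plays independent guessing rounds. In a round with parameter N, a number i ≤ N is drawn
with probability proportional to r^i, where r = 4^N. The next state has index 0, so i survives only
in memory. The player then names j ≤ N and is punished with probability r^(-(j+1)). The rewards are
+i and -j, and -(N+1) on punishment, in a unit so large that overestimating (j > i) or being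
punished pushes the total below minus the elapsed time. Infinitely many failures therefore give a
liminf of at most -1. Naming i exactly and being punished only finitely often gives a liminf ≥ 0.

The two kinds of error are balanced. If j < i, the risk is at least r^(-i); if j > i, failure is
certain. So any wrong name fails with conditional probability at least r^(-i)
(`success_add_scale_le`). Since i has probability r^i/Z, with Z = `total N`, each value i that is
always named wrongly contributes at least 1/Z to the failure probability. The distribution of the
name depends only on the mode in which it is chosen. If only K modes are possible then, the
correct-name probabilities of the N+1 values, maximised over modes, sum to at most K, so the round
fails with probability at least (N+1-K)/Z, whatever the past (`roundSuccess_add_le`). The parameter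
N is used in exactly Z rounds, so the total for N is at least N+1-K and the sum over all rounds
diverges. Hence failures recur almost surely (`runMeasure_MP_eq_zero`). This covers finite memory,
and also k bits plus a step counter, because the counter is determined by its earlier value.

The strategy `honest` names i itself and fails only by punishment, with probability (N+1)/(Z r) per
round. The total for N is (N+1)/4^N, which is summable, so by Borel–Cantelli it wins almost surely
(`honest_mem_MP`). -/

/-- The first `n + 1` elements of an infinite sequence. -/
abbrev Hist.of {X : Type*} (n : ℕ) (w : ℕ → X) : Hist X n := fun i => w i

lemma Hist.measurable_of {X : Type*} [MeasurableSpace X] (n : ℕ) :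
    Measurable (Hist.of n : (ℕ → X) → Hist X n) :=
  Preorder.measurable_frestrictLe (X := fun _ => X) n

/-! ### Laws of random sequences: one-step disintegration, cylinders, uniqueness. -/

section PathMeasure

variable {X : Type*} [Countable X] [MeasurableSpace X] [DiscreteMeasurableSpace X]

instance pathMeasure.instIsProbabilityMeasure (f : ∀ n, Hist X n → PMF X) (x₀ : X) :
    IsProbabilityMeasure (pathMeasure f x₀) := by
  unfold pathMeasure; infer_instance

lemma pathMeasure_ae_zero (f : ∀ n, Hist X n → PMF X) (x₀ : X) :
    ∀ᵐ w ∂pathMeasure f x₀, w 0 = x₀ := by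
  have h := Kernel.traj_map_frestrictLe_apply (X := fun _ => X) (κ := stepKernel f) 0 0
    (fun _ => x₀)
  rw [Kernel.partialTraj_self, Kernel.id_apply] at h
  have h2 : ∀ᵐ y ∂(Measure.dirac (fun _ => x₀) : Measure (Hist X 0)), y.last = x₀ := by
    rw [ae_dirac_eq]; exact rfl
  rw [← h] at h2
  exact ae_of_ae_map (Preorder.measurable_frestrictLe (X := fun _ => X) 0).aemeasurable h2

/-- The law of the element with index `n + 1` given the first `n + 1` elements. -/
lemma lintegral_pathMeasure_succ (f : ∀ n, Hist X n → PMF X) (x₀ : X) (n : ℕ)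
    (F : Hist X n → X → ENNReal) :
    ∫⁻ w, F (Hist.of n w) (w (n + 1)) ∂pathMeasure f x₀ =
      ∫⁻ w, ∑' x, f n (Hist.of n w) x * F (Hist.of n w) x ∂pathMeasure f x₀ := by
  have h := Kernel.partialTraj_compProd_eq_map_traj (X := fun _ => X) (κ := stepKernel f)
    (Nat.zero_le n) (x₀ := fun _ => x₀)
  rw [← Kernel.traj_map_frestrictLe_apply] at h
  have hF : Measurable (fun p : Hist X n × X => F p.1 p.2) := Measurable.of_discrete
  have h1 : ∫⁻ w, F (Hist.of n w) (w (n + 1)) ∂pathMeasure f x₀ =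
      ∫⁻ p, F p.1 p.2 ∂((pathMeasure f x₀).map (fun w => (Hist.of n w, w (n + 1)))) := by
    rw [lintegral_map hF ((Hist.measurable_of n).prodMk (measurable_pi_apply _))]
  rw [h1]
  change ∫⁻ p, F p.1 p.2 ∂((Kernel.traj (X := fun _ => X) (stepKernel f) 0 (fun _ => x₀)).map
    (fun x => (Preorder.frestrictLe n x, x (n + 1)))) = _
  rw [← h, Measure.lintegral_compProd hF, lintegral_map Measurable.of_discrete
    (Preorder.measurable_frestrictLe (X := fun _ => X) n)]
  refine lintegral_congr fun w => ?_
  change ∫⁻ x, F (Hist.of n w) x ∂(f n (Hist.of n w)).toMeasure = _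
  rw [lintegral_countable']
  refine tsum_congr fun x => ?_
  rw [PMF.toMeasure_apply_singleton _ _ (measurableSet_singleton x), mul_comm]

/-- The measure of a cylinder is the product of the one-step probabilities. -/
lemma pathMeasure_cylinder_succ (f : ∀ n, Hist X n → PMF X) (x₀ : X) (n : ℕ) (h : ℕ → X) :
    pathMeasure f x₀ {w | Hist.of (n + 1) w = Hist.of (n + 1) h} =
      pathMeasure f x₀ {w | Hist.of n w = Hist.of n h} * f n (Hist.of n h) (h (n + 1)) := by
  classical
  have hm : ∀ m, MeasurableSet {w : ℕ → X | Hist.of m w = Hist.of m h} := fun m =>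
    Hist.measurable_of m (measurableSet_singleton (Hist.of m h))
  have key := lintegral_pathMeasure_succ f x₀ n
    (fun g x => if g = Hist.of n h ∧ x = h (n + 1) then 1 else 0)
  have e1 : ∀ w : ℕ → X, (if Hist.of n w = Hist.of n h ∧ w (n + 1) = h (n + 1)
      then (1 : ENNReal) else 0) =
      Set.indicator {w | Hist.of (n + 1) w = Hist.of (n + 1) h} 1 w := by
    intro w
    have : (Hist.of n w = Hist.of n h ∧ w (n + 1) = h (n + 1)) ↔
        Hist.of (n + 1) w = Hist.of (n + 1) h := by
      constructor
      · rintro ⟨h1, h2⟩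
        funext ⟨i, hi⟩
        rcases Nat.lt_or_ge n i with hlt | hge
        · have : i = n + 1 := le_antisymm (Finset.mem_Iic.1 hi) hlt
          subst this; exact h2
        · exact congrFun h1 ⟨i, Finset.mem_Iic.2 hge⟩
      · intro h1
        refine ⟨?_, congrFun h1 ⟨n + 1, Finset.mem_Iic.2 le_rfl⟩⟩
        funext ⟨i, hi⟩
        exact congrFun h1 ⟨i, Finset.mem_Iic.2 ((Finset.mem_Iic.1 hi).trans (Nat.le_succ n))⟩
    simp [Set.indicator, this]
  have e2 : ∀ w : ℕ → X, (∑' x, f n (Hist.of n w) x *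
      (if Hist.of n w = Hist.of n h ∧ x = h (n + 1) then (1 : ENNReal) else 0)) =
      Set.indicator {w | Hist.of n w = Hist.of n h} (fun _ => f n (Hist.of n h) (h (n + 1))) w := by
    intro w
    by_cases hw : Hist.of n w = Hist.of n h
    · rw [Set.indicator_of_mem (show w ∈ {w | Hist.of n w = Hist.of n h} from hw), hw,
        tsum_eq_single (h (n + 1))]
      · simp
      · intro x hx; simp [hx]
    · rw [Set.indicator_of_notMem (show w ∉ {w | Hist.of n w = Hist.of n h} from hw)]
      simp [hw]
  rw [lintegral_congr e1, lintegral_congr e2, lintegral_indicator_one (hm _),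
    lintegral_indicator_const (hm _)] at key
  rw [key, mul_comm]

/-- A finite measure on sequences is determined by its values on cylinders. -/
lemma measure_ext_of_cylinder {μ ν : Measure (ℕ → X)} [IsFiniteMeasure μ]
    (H : ∀ (n : ℕ) (h : ℕ → X), μ {w | Hist.of n w = Hist.of n h} =
      ν {w | Hist.of n w = Hist.of n h}) [IsFiniteMeasure ν] : μ = ν := by
  have hmap : ∀ n, μ.map (Preorder.frestrictLe (π := fun _ => X) n) =
      ν.map (Preorder.frestrictLe (π := fun _ => X) n) := by
    intro n
    refine Measure.ext_of_singleton fun g => ?_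
    have hm := Preorder.measurable_frestrictLe (X := fun _ : ℕ => X) n
    rw [Measure.map_apply hm (measurableSet_singleton g),
      Measure.map_apply hm (measurableSet_singleton g)]
    -- The history is extended to an infinite sequence; the filler beyond n is arbitrary.
    have hg := H n (fun i => if hi : i ≤ n then g ⟨i, Finset.mem_Iic.2 hi⟩ else Hist.last g)
    have e : Hist.of n (fun i => if hi : i ≤ n then g ⟨i, Finset.mem_Iic.2 hi⟩ else Hist.last g) =
        g := by
      funext ⟨i, hi⟩
      exact dif_pos (Finset.mem_Iic.1 hi)
    rw [e] at hg
    exact hg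
  have hp : IsProjectiveMeasureFamily (α := fun _ : ℕ => X)
      (fun I : Finset ℕ => ν.map (I.restrict (π := fun _ => X))) := by
    intro I J hJI
    rw [Measure.map_map (Finset.measurable_restrict₂ hJI) (Finset.measurable_restrict _)]
    rfl
  have h1 : IsProjectiveLimit (α := fun _ : ℕ => X) ν
      (fun I : Finset ℕ => ν.map (I.restrict (π := fun _ => X))) :=
    fun I => rfl
  have h2 : IsProjectiveLimit (α := fun _ : ℕ => X) μ
      (fun I : Finset ℕ => ν.map (I.restrict (π := fun _ => X))) :=
    (isProjectiveLimit_nat_iff hp μ).2 fun n => hmap n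
  exact h2.unique h1

/-- Steps that have probability zero almost surely do not happen. -/
lemma pathMeasure_ae_succ (f : ∀ n, Hist X n → PMF X) (x₀ : X) (P : ∀ n, Hist X n → X → Prop)
    (hP : ∀ n h, ∀ x ∈ (f n h).support, P n h x) :
    ∀ᵐ w ∂pathMeasure f x₀, ∀ n, P n (Hist.of n w) (w (n + 1)) := by
  classical
  rw [ae_all_iff]
  intro n
  have key := lintegral_pathMeasure_succ f x₀ n (fun g x => if P n g x then 0 else 1)
  have e : ∀ w : ℕ → X, (∑' x, f n (Hist.of n w) x *
      (if P n (Hist.of n w) x then (0 : ENNReal) else 1)) = 0 := by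
    intro w
    rw [ENNReal.tsum_eq_zero]
    intro x
    by_cases hx : P n (Hist.of n w) x
    · simp [hx]
    · have : f n (Hist.of n w) x = 0 := by
        by_contra h0
        exact hx (hP n _ x h0)
      simp [this]
  rw [lintegral_congr e, lintegral_zero, lintegral_eq_zero_iff] at key
  · filter_upwards [key] with w hw
    by_contra hn
    simp [hn] at hw
  · exact (Measurable.of_discrete (f := fun p : Hist X n × X => if P n p.1 p.2
      then (0 : ENNReal) else 1)).comp
      ((Hist.measurable_of n).prodMk (measurable_pi_apply (n + 1)))

/-- Four steps of a time-homogeneous chain, given its past. -/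
lemma lintegral_chain_four (κ : X → PMF X) (x₀ : X) (n : ℕ) (A : Hist X n → ENNReal)
    (g : X → X → X → X → X → ENNReal) :
    ∫⁻ w, A (Hist.of n w) * g (w n) (w (n + 1)) (w (n + 2)) (w (n + 3)) (w (n + 4))
        ∂pathMeasure (fun _ h => κ h.last) x₀ =
      ∫⁻ w, A (Hist.of n w) * ∑' x, κ (w n) x * ∑' y, κ x y * ∑' z, κ y z * ∑' u, κ z u *
        g (w n) x y z u ∂pathMeasure (fun _ h => κ h.last) x₀ := by
  have step : ∀ (m : ℕ) (F : Hist X m → X → ENNReal) (B : Hist X m → ENNReal),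
      ∫⁻ w, B (Hist.of m w) * F (Hist.of m w) (w (m + 1))
        ∂pathMeasure (fun _ h => κ h.last) x₀ =
      ∫⁻ w, B (Hist.of m w) * ∑' x, κ (w m) x * F (Hist.of m w) x
        ∂pathMeasure (fun _ h => κ h.last) x₀ := by
    intro m F B
    rw [lintegral_pathMeasure_succ _ _ m (fun h x => B h * F h x)]
    refine lintegral_congr fun w => ?_
    rw [← ENNReal.tsum_mul_left]
    refine tsum_congr fun x => ?_
    rw [mul_left_comm]
    rfl
  have i0 : ∀ {a b : ℕ}, a ≤ b → a ∈ Finset.Iic b := fun h => Finset.mem_Iic.2 h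
  let r : ∀ {m : ℕ}, n ≤ m → Hist X m → Hist X n := fun hm h i =>
    h ⟨i, Finset.mem_Iic.2 ((Finset.mem_Iic.1 i.2).trans hm)⟩
  -- Integrate out the latest step first: each application of `step` leaves a function of a history
  -- one shorter.
  refine (step (n + 3) (fun h u => g (h ⟨n, i0 (by omega)⟩) (h ⟨n + 1, i0 (by omega)⟩)
    (h ⟨n + 2, i0 (by omega)⟩) (h ⟨n + 3, i0 (by omega)⟩) u)
    (fun h => A (r (by omega) h))).trans ?_
  refine (step (n + 2) (fun h z => ∑' u, κ z u * g (h ⟨n, i0 (by omega)⟩)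
    (h ⟨n + 1, i0 (by omega)⟩) (h ⟨n + 2, i0 (by omega)⟩) z u)
    (fun h => A (r (by omega) h))).trans ?_
  refine (step (n + 1) (fun h y => ∑' z, κ y z * ∑' u, κ z u * g (h ⟨n, i0 (by omega)⟩)
    (h ⟨n + 1, i0 (by omega)⟩) y z u) (fun h => A (r (by omega) h))).trans ?_
  exact step n (fun h x => ∑' y, κ x y * ∑' z, κ y z * ∑' u, κ z u * g (h ⟨n, i0 (by omega)⟩)
    x y z u) A

end PathMeasure

/-! ### Strategies induced by a memory, as projections of a Markov chain. -/

namespace MDP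

section Support

variable {S Mem : Type*} {M : MDP S}

lemma MemoryUpdate.trans_of_mem_support (τ : M.MemoryUpdate Mem) {x y : Mem × S}
    (h : y ∈ (τ.next x).support) : M.trans x.2 y.2 := by
  obtain ⟨m, s⟩ := x
  obtain ⟨m', s'⟩ := y
  by_cases hs : s ∈ M.controlled
  · exact τ.next_controlled m s hs _ h
  · refine M.prob_support s hs s' ?_
    rw [PMF.mem_support_iff, ← τ.next_random m s hs s']
    intro h0
    exact h (ENNReal.tsum_eq_zero.1 h0 m')

lemma Strategy.trans_of_mem_support (σ : M.Strategy) {n : ℕ} {h : Hist S n} {s : S}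
    (hs : s ∈ (σ.next n h).support) : M.trans h.last s := by
  unfold Strategy.next at hs
  split_ifs at hs with hc
  · exact σ.act_support n h hc s hs
  · exact M.prob_support _ hc s hs

end Support

lemma measurableSet_follows {S Mem : Type*} [Countable S] [MeasurableSpace S]
    [DiscreteMeasurableSpace S] [MeasurableSpace Mem] {n : ℕ} (h : Hist S n) :
    MeasurableSet (follows Mem h) := by
  have : follows Mem h = ⋂ i : Finset.Iic n, {w : ℕ → Mem × S | (w i).2 = h i} := by
    ext w; simp [follows]
  rw [this]
  exact MeasurableSet.iInter fun i =>
    (measurable_snd.comp (measurable_pi_apply _)) (measurableSet_singleton (h i))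

lemma measurableSet_mode {S Mem : Type*} [MeasurableSpace S] [MeasurableSpace Mem]
    [DiscreteMeasurableSpace Mem] (n : ℕ) (m : Mem) :
    MeasurableSet {w : ℕ → Mem × S | (w n).1 = m} :=
  (measurable_fst.comp (measurable_pi_apply n)) (measurableSet_singleton m)

variable {S : Type*} [Countable S] [MeasurableSpace S] [DiscreteMeasurableSpace S]
variable {Mem : Type*} [Countable Mem] [MeasurableSpace Mem] [DiscreteMeasurableSpace Mem]
variable {M : MDP S}

/-- Splitting on the current mode is needed because the state sequence alone is not Markov. -/
lemma MemoryUpdate.chain_follows_succ (τ : M.MemoryUpdate Mem) (m₀ : Mem) (s₀ : S) (n : ℕ)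
    (h : ℕ → S) :
    τ.chain m₀ s₀ (follows Mem (Hist.of (n + 1) h)) =
      ∑' m, τ.chain m₀ s₀ (follows Mem (Hist.of n h) ∩ {w | (w n).1 = m}) *
        ∑' m', τ.next (m, h n) (m', h (n + 1)) := by
  classical
  have key := lintegral_pathMeasure_succ (fun _ h => τ.next h.last) (m₀, s₀) n
    (fun g x => if (∀ i, (g i).2 = h i) ∧ x.2 = h (n + 1) then 1 else 0)
  have e1 : ∀ w : ℕ → Mem × S, (if (∀ i, (Hist.of n w i).2 = h i) ∧ (w (n + 1)).2 = h (n + 1)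
      then (1 : ENNReal) else 0) =
      Set.indicator (follows Mem (Hist.of (n + 1) h)) 1 w := by
    intro w
    have : ((∀ i, (Hist.of n w i).2 = h i) ∧ (w (n + 1)).2 = h (n + 1)) ↔
        w ∈ follows Mem (Hist.of (n + 1) h) := by
      constructor
      · rintro ⟨h1, h2⟩ ⟨i, hi⟩
        rcases Nat.lt_or_ge n i with hlt | hge
        · have : i = n + 1 := le_antisymm (Finset.mem_Iic.1 hi) hlt
          subst this; exact h2
        · exact h1 ⟨i, Finset.mem_Iic.2 hge⟩
      · intro h1
        refine ⟨?_, h1 ⟨n + 1, Finset.mem_Iic.2 le_rfl⟩⟩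
        rintro ⟨i, hi⟩
        exact h1 ⟨i, Finset.mem_Iic.2 ((Finset.mem_Iic.1 hi).trans (Nat.le_succ n))⟩
    simp only [this, Set.indicator, Pi.one_apply]
  have e2 : ∀ w : ℕ → Mem × S, (∑' x, τ.next (Hist.of n w).last x *
      (if (∀ i, (Hist.of n w i).2 = h i) ∧ x.2 = h (n + 1) then (1 : ENNReal) else 0)) =
      ∑' m, Set.indicator (follows Mem (Hist.of n h) ∩ {w | (w n).1 = m})
        (fun _ => ∑' m', τ.next (m, h n) (m', h (n + 1))) w := by
    intro w
    by_cases hw : w ∈ follows Mem (Hist.of n h)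
    · have hw' : ∀ i, (Hist.of n w i).2 = h i := hw
      rw [tsum_eq_single (w n).1]
      · rw [Set.indicator_of_mem (by exact ⟨hw, rfl⟩), ENNReal.tsum_prod']
        refine tsum_congr fun m' => ?_
        rw [tsum_eq_single (h (n + 1))]
        · have : (Hist.of n w).last = ((w n).1, h n) :=
            Prod.ext rfl (hw' ⟨n, Finset.mem_Iic.2 le_rfl⟩)
          rw [this, if_pos ⟨hw', rfl⟩, mul_one]
        · intro s hs
          rw [if_neg (fun hh => hs hh.2), mul_zero]
      · intro m hm
        exact Set.indicator_of_notMem (fun hh => hm hh.2.symm) _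
    · have hw' : ¬ ∀ i, (Hist.of n w i).2 = h i := hw
      have r : ∀ m, Set.indicator (follows Mem (Hist.of n h) ∩ {w | (w n).1 = m})
        (fun _ => ∑' m', τ.next (m, h n) (m', h (n + 1))) w = 0 := fun m =>
          Set.indicator_of_notMem (fun hh => hw hh.1) _
      simp only [r, hw', false_and, if_false, mul_zero, tsum_zero]
  rw [lintegral_congr e1, lintegral_congr e2,
    lintegral_indicator_one (measurableSet_follows _), lintegral_tsum] at key
  · refine key.trans (tsum_congr fun m => ?_)
    rw [lintegral_indicator_const ((measurableSet_follows _).inter (measurableSet_mode n m)),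
      mul_comm]
    rfl
  · intro m
    exact (measurable_const.indicator
      ((measurableSet_follows _).inter (measurableSet_mode n m))).aemeasurable

lemma MemoryUpdate.tsum_chain_follows_inter (τ : M.MemoryUpdate Mem) (m₀ : Mem) (s₀ : S) {n : ℕ}
    (h : Hist S n) :
    ∑' m, τ.chain m₀ s₀ (follows Mem h ∩ {w | (w n).1 = m}) = τ.chain m₀ s₀ (follows Mem h) := by
  rw [← measure_iUnion]
  · congr 1
    ext w; simp
  · intro m m' hm
    refine Set.disjoint_left.2 fun w h1 h2 => hm (h1.2.symm.trans h2.2)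
  · exact fun m => (measurableSet_follows _).inter (measurableSet_mode n m)

/-- The run measure of an implemented strategy is the projection of the law of the chain. -/
lemma MemoryUpdate.Implements.runMeasure_eq {τ : M.MemoryUpdate Mem} {m₀ : Mem} {s₀ : S}
    {σ : M.Strategy} (hσ : τ.Implements m₀ s₀ σ) :
    M.runMeasure s₀ σ = (τ.chain m₀ s₀).map (fun w n => (w n).2) := by
  have hmeas : Measurable (fun (w : ℕ → Mem × S) n => (w n).2) :=
    measurable_pi_lambda _ fun n => measurable_snd.comp (measurable_pi_apply n)
  have : IsProbabilityMeasure (τ.chain m₀ s₀) := pathMeasure.instIsProbabilityMeasure _ _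
  have : IsProbabilityMeasure (M.runMeasure s₀ σ) := pathMeasure.instIsProbabilityMeasure _ _
  have := Measure.isProbabilityMeasure_map (μ := τ.chain m₀ s₀) hmeas.aemeasurable
  refine measure_ext_of_cylinder fun n h => ?_
  have hcyl : MeasurableSet {w : ℕ → S | Hist.of n w = Hist.of n h} :=
    Hist.measurable_of n (measurableSet_singleton (Hist.of n h))
  rw [Measure.map_apply hmeas hcyl]
  have hpre : ∀ n, (fun (w : ℕ → Mem × S) n => (w n).2) ⁻¹' {w | Hist.of n w = Hist.of n h} =
      follows Mem (Hist.of n h) := by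
    intro n
    ext w
    exact funext_iff
  rw [hpre]
  clear hcyl
  induction n with
  | zero =>
    have a1 : M.runMeasure s₀ σ {w | Hist.of 0 w = Hist.of 0 h} =
        M.runMeasure s₀ σ {_w | s₀ = h 0} := by
      refine measure_congr ?_
      filter_upwards [pathMeasure_ae_zero σ.next s₀] with w hw
      refine propext ⟨fun h1 => hw.symm.trans (congrFun h1 ⟨0, Finset.mem_Iic.2 le_rfl⟩),
        fun h1 => ?_⟩
      funext ⟨i, hi⟩
      obtain rfl : i = 0 := Nat.le_zero.1 (Finset.mem_Iic.1 hi)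
      exact hw.trans h1
    have a2 : τ.chain m₀ s₀ (follows Mem (Hist.of 0 h)) =
        τ.chain m₀ s₀ {_w | s₀ = h 0} := by
      refine measure_congr ?_
      filter_upwards [pathMeasure_ae_zero (fun _ h => τ.next h.last) (m₀, s₀)] with w hw
      have hw2 : (w 0).2 = s₀ := by rw [hw]
      refine propext ⟨fun h1 => hw2.symm.trans (h1 ⟨0, Finset.mem_Iic.2 le_rfl⟩), fun h1 => ?_⟩
      rintro ⟨i, hi⟩
      obtain rfl : i = 0 := Nat.le_zero.1 (Finset.mem_Iic.1 hi)
      exact hw2.trans h1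
    rw [a1, a2]
    by_cases hs : s₀ = h 0
    · rw [show {_w : ℕ → S | s₀ = h 0} = Set.univ from Set.eq_univ_of_forall fun _ => hs,
        show {_w : ℕ → Mem × S | s₀ = h 0} = Set.univ from Set.eq_univ_of_forall fun _ => hs,
        measure_univ, measure_univ]
    · simp [hs]
  | succ n ih =>
    have ih' := ih
    unfold runMeasure at ih' ⊢
    rw [pathMeasure_cylinder_succ, ih', τ.chain_follows_succ]
    -- On null histories the strategy is unconstrained, but both sides vanish. Otherwise, in a
    -- controlled state the normalisation of `modeProb` cancels; in a random state the successor law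
    -- does not depend on the mode.
    by_cases h0 : τ.chain m₀ s₀ (follows Mem (Hist.of n h)) = 0
    · rw [h0, zero_mul]
      symm
      rw [ENNReal.tsum_eq_zero]
      intro m
      rw [measure_mono_null Set.inter_subset_left h0, zero_mul]
    · have hlast : (Hist.of n h).last = h n := rfl
      by_cases hc : (Hist.of n h).last ∈ M.controlled
      · rw [Strategy.next, dif_pos hc, hσ n _ hc h0, ← ENNReal.tsum_mul_left]
        refine tsum_congr fun m => ?_
        rw [ENNReal.tsum_mul_left, ← mul_assoc, MemoryUpdate.modeProb,
          cond_apply (measurableSet_follows _), ← mul_assoc,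
          ENNReal.mul_inv_cancel h0 (measure_ne_top _ _), one_mul, hlast]
      · rw [Strategy.next, dif_neg hc]
        have : ∀ m, ∑' m', τ.next (m, h n) (m', h (n + 1)) = M.prob _ hc (h (n + 1)) :=
          fun m => τ.next_random m (h n) hc _
        simp only [this]
        rw [ENNReal.tsum_mul_right, τ.tsum_chain_follows_inter]

end MDP

lemma PMF.tsum_map_mul {α β : Type*} (p : PMF α) (f : α → β) (F : β → ENNReal) :
    ∑' b, p.map f b * F b = ∑' a, p a * F (f a) := by
  classical
  simp only [PMF.map_apply, ← ENNReal.tsum_mul_right]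
  rw [ENNReal.tsum_comm]
  refine tsum_congr fun a => ?_
  rw [tsum_eq_single (f a)]
  · simp
  · intro b hb; simp [hb]

/-! The guessing MDP proceeds in rounds of four steps. In a round with parameter `N` a number
`i ≤ N` is drawn, the player (who does not see `i` in the current state) names a number `j ≤ N`,
and then a coin decides whether the player is punished. -/

/-! ### The guessing MDP: rewards and their deterministic consequences. -/

namespace Guess

/-- The ratio of consecutive weights in a round with parameter `N`. -/
def ratio (N : ℕ) : ℕ := 4 ^ N

/-- The sum of the weights in a round with parameter `N`. -/
def total (N : ℕ) : ℕ := ∑ i ∈ Finset.range (N + 1), ratio N ^ i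

lemma ratio_pos (N : ℕ) : 0 < ratio N := Nat.pow_pos (by norm_num)

lemma succ_le_total (N : ℕ) : N + 1 ≤ total N := by
  have := Finset.card_nsmul_le_sum (Finset.range (N + 1)) (fun i => ratio N ^ i) 1
    (fun i _ => Nat.one_le_iff_ne_zero.2 (pow_pos (ratio_pos N) i).ne')
  simpa [total] using this

lemma total_pos (N : ℕ) : 0 < total N := (Nat.succ_pos N).trans_le (succ_le_total N)

/-- Any enumeration will do: the order of the rounds is irrelevant, as only sums of nonnegative
terms over all rounds matter. -/
lemma exists_roundEquiv : Nonempty (ℕ ≃ Σ N, Fin (total N)) := by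
  have : Infinite (Σ N, Fin (total N)) :=
    Infinite.of_injective (fun N => (⟨N, ⟨0, total_pos N⟩⟩ : Σ N, Fin (total N)))
      (fun a b h => congrArg Sigma.fst h)
  obtain ⟨d⟩ := nonempty_denumerable (Σ N, Fin (total N))
  exact ⟨(Denumerable.eqv _).symm⟩

/-- An enumeration in which the parameter `N` occurs `total N` times. -/
noncomputable def roundEquiv : ℕ ≃ Σ N, Fin (total N) := exists_roundEquiv.some

/-- The parameter of the round `n`. -/
noncomputable def param (n : ℕ) : ℕ := (roundEquiv n).1

/-- The largest possible gain in the first `n` rounds. -/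
noncomputable def maxGain : ℕ → ℕ
  | 0 => 0
  | n + 1 => maxGain n + param n * (maxGain n + 4 * (n + 1))

/-- The unit of the rewards in the round `n`. -/
noncomputable def unit (n : ℕ) : ℕ := maxGain n + 4 * (n + 1)

/-- The largest index of a state at time `t`. -/
noncomputable def bound (t : ℕ) : ℕ :=
  if t % 4 = 0 then 1 else if t % 4 = 2 then 0 else param (t / 4)

/-- The reward for entering the state with index `x` at time `t`. -/
noncomputable def gain (t x : ℕ) : ℝ :=
  if t % 4 = 1 then x * unit (t / 4)
  else if t % 4 = 3 then -(x * unit (t / 4))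
  else if t % 4 = 0 then -(x * ((param (t / 4 - 1) + 1) * unit (t / 4 - 1)))
  else 0

lemma bound_zero (n : ℕ) : bound (4 * n + 4) = 1 := by
  rw [bound, if_pos (by omega)]

lemma bound_one (n : ℕ) : bound (4 * n + 1) = param n := by
  rw [bound, if_neg (by omega), if_neg (by omega), show (4 * n + 1) / 4 = n by omega]

lemma bound_two (n : ℕ) : bound (4 * n + 2) = 0 := by
  rw [bound, if_neg (by omega), if_pos (by omega)]

lemma bound_three (n : ℕ) : bound (4 * n + 3) = param n := by
  rw [bound, if_neg (by omega), if_neg (by omega), show (4 * n + 3) / 4 = n by omega]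

lemma gain_one (n x : ℕ) : gain (4 * n + 1) x = x * unit n := by
  rw [gain, if_pos (by omega), show (4 * n + 1) / 4 = n by omega]

lemma gain_two (n x : ℕ) : gain (4 * n + 2) x = 0 := by
  rw [gain, if_neg (by omega), if_neg (by omega), if_neg (by omega)]

lemma gain_three (n x : ℕ) : gain (4 * n + 3) x = -(x * unit n) := by
  rw [gain, if_neg (by omega), if_pos (by omega), show (4 * n + 3) / 4 = n by omega]

lemma gain_four (n x : ℕ) :
    gain (4 * n + 4) x = -(x * ((param n + 1) * unit n)) := by
  rw [gain, if_neg (by omega), if_neg (by omega), if_pos (by omega),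
    show (4 * n + 4) / 4 - 1 = n by omega]

/-- The total reward of the first `n` steps of the run with indices `x`. -/
noncomputable def gainSum (x : ℕ → ℕ) (n : ℕ) : ℝ := ∑ j ∈ Finset.range n, gain (j + 1) (x (j + 1))

lemma gainSum_succ (x : ℕ → ℕ) (n : ℕ) :
    gainSum x (n + 1) = gainSum x n + gain (n + 1) (x (n + 1)) := Finset.sum_range_succ _ _

lemma gainSum_one (x : ℕ → ℕ) (n : ℕ) :
    gainSum x (4 * n + 1) = gainSum x (4 * n) + x (4 * n + 1) * unit n := by
  rw [gainSum_succ, gain_one]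

lemma gainSum_two (x : ℕ → ℕ) (n : ℕ) :
    gainSum x (4 * n + 2) = gainSum x (4 * n) + x (4 * n + 1) * unit n := by
  rw [gainSum_succ, gain_two, gainSum_one, add_zero]

lemma gainSum_three (x : ℕ → ℕ) (n : ℕ) :
    gainSum x (4 * n + 3) =
      gainSum x (4 * n) + x (4 * n + 1) * unit n - x (4 * n + 3) * unit n := by
  rw [gainSum_succ, gain_three, gainSum_two, ← sub_eq_add_neg]

lemma gainSum_four (x : ℕ → ℕ) (n : ℕ) :
    gainSum x (4 * n + 4) = gainSum x (4 * n) + x (4 * n + 1) * unit n - x (4 * n + 3) * unit n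
      - x (4 * n + 4) * ((param n + 1) * unit n) := by
  rw [gainSum_succ, gain_four, gainSum_three, ← sub_eq_add_neg]

lemma gainSum_le (x : ℕ → ℕ) (hx : ∀ t, x (t + 1) ≤ bound (t + 1)) (n : ℕ) :
    gainSum x (4 * n) ≤ maxGain n := by
  induction n with
  | zero => simp [gainSum, maxGain]
  | succ n ih =>
    rw [Nat.mul_succ, gainSum_four]
    have h1 : (x (4 * n + 1) : ℝ) ≤ param n := by
      exact_mod_cast (hx (4 * n)).trans (bound_one n).le
    have h2 : (x (4 * n + 1) : ℝ) * unit n ≤ param n * unit n := by gcongr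
    have h3 : (0 : ℝ) ≤ x (4 * n + 3) * unit n := by positivity
    have h4 : (0 : ℝ) ≤ x (4 * n + 4) * ((param n + 1) * unit n) := by positivity
    have h5 : (maxGain (n + 1) : ℝ) = maxGain n + param n * unit n := by
      simp [maxGain, unit]
    linarith

/-- The player fails in the round `n`: the number named is too large, or the coin was
unfavourable. -/
def Fails (x : ℕ → ℕ) (n : ℕ) : Prop := x (4 * n + 1) < x (4 * n + 3) ∨ x (4 * n + 4) ≠ 0

/-- Before round n the total is at most `maxGain n`. Overestimating loses at least one net unit;
being punished loses at least N+1 units against a gain of at most N. Either way the total is at most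
`maxGain n - unit n = -4(n+1)`. -/
lemma exists_gainSum_le_of_fails {x : ℕ → ℕ} (hx : ∀ t, x (t + 1) ≤ bound (t + 1)) {n : ℕ}
    (hn : Fails x n) : ∃ m, n ≤ m ∧ 0 < m ∧ gainSum x m ≤ -m := by
  have h0 := gainSum_le x hx n
  have hu : (unit n : ℝ) = maxGain n + 4 * (n + 1) := by simp [unit]
  have hu0 : (0 : ℝ) ≤ unit n := by positivity
  rcases hn with h | h
  · refine ⟨4 * n + 3, by omega, by omega, ?_⟩
    rw [gainSum_three]
    have h1 : (x (4 * n + 1) : ℝ) + 1 ≤ x (4 * n + 3) := by exact_mod_cast h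
    have h2 := mul_le_mul_of_nonneg_right h1 hu0
    push_cast
    linarith
  · refine ⟨4 * n + 4, by omega, by omega, ?_⟩
    rw [gainSum_four]
    have h1 : (x (4 * n + 1) : ℝ) ≤ param n := by
      exact_mod_cast (hx (4 * n)).trans (bound_one n).le
    have h2 := mul_le_mul_of_nonneg_right h1 hu0
    have h3 : (1 : ℝ) ≤ x (4 * n + 4) := by exact_mod_cast Nat.one_le_iff_ne_zero.2 h
    have h4 : (0 : ℝ) ≤ (param n + 1) * unit n := by positivity
    have h5 := mul_le_mul_of_nonneg_right h3 h4
    have h6 : (0 : ℝ) ≤ x (4 * n + 3) * unit n := by positivity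
    push_cast
    linarith

lemma liminf_lt_zero_of_frequently_fails {x : ℕ → ℕ} (hx : ∀ t, x (t + 1) ≤ bound (t + 1))
    (h : ∃ᶠ n in atTop, Fails x n) :
    liminf (fun n : ℕ => ((1 / (n : ℝ) * gainSum x n : ℝ) : EReal)) atTop < 0 := by
  have hf : ∃ᶠ n : ℕ in atTop, ((1 / (n : ℝ) * gainSum x n : ℝ) : EReal) ≤ ((-1 : ℝ) : EReal) := by
    rw [frequently_atTop] at h ⊢
    intro a
    obtain ⟨n, han, hn⟩ := h a
    obtain ⟨m, hnm, hm, hle⟩ := exists_gainSum_le_of_fails hx hn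
    refine ⟨m, han.trans hnm, ?_⟩
    have hm' : (0 : ℝ) < m := by exact_mod_cast hm
    rw [EReal.coe_le_coe_iff, one_div, inv_mul_le_iff₀ hm']
    linarith
  refine (liminf_le_of_frequently_le' hf).trans_lt ?_
  exact_mod_cast (by norm_num : (-1 : ℝ) < 0)

/-- After the last punishment every round has net reward 0 and never dips below its starting total,
so the totals are bounded below by a constant, which vanishes in the average. -/
lemma zero_le_liminf {x : ℕ → ℕ} (hx : ∀ n, x (4 * n + 3) = x (4 * n + 1))
    (h : ∀ᶠ n in atTop, x (4 * n + 4) = 0) :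
    0 ≤ liminf (fun n : ℕ => ((1 / (n : ℝ) * gainSum x n : ℝ) : EReal)) atTop := by
  obtain ⟨a, ha⟩ := eventually_atTop.1 h
  have h4 : ∀ n, a ≤ n → gainSum x (4 * n) = gainSum x (4 * a) := by
    intro n hn
    induction n, hn using Nat.le_induction with
    | base => rfl
    | succ n hn ih =>
      rw [Nat.mul_succ, gainSum_four, ha n hn, hx n, ← ih]
      simp
  have hge : ∀ m, 4 * a ≤ m → gainSum x (4 * a) ≤ gainSum x m := by
    intro m hm
    obtain ⟨n, r, hr, rfl⟩ : ∃ n r, r < 4 ∧ m = 4 * n + r :=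
      ⟨m / 4, m % 4, Nat.mod_lt _ (by norm_num), (Nat.div_add_mod m 4).symm⟩
    have hn := h4 n (by omega)
    have hp : (0 : ℝ) ≤ x (4 * n + 1) * unit n := by positivity
    interval_cases r
    · exact hn.ge
    · rw [gainSum_one]; linarith
    · rw [gainSum_two]; linarith
    · rw [gainSum_three, hx n]; linarith
  have ht : Tendsto (fun n : ℕ => ((1 / (n : ℝ) * gainSum x (4 * a) : ℝ) : EReal)) atTop
      (nhds 0) := by
    have h1 : Tendsto (fun n : ℕ => 1 / (n : ℝ) * gainSum x (4 * a)) atTop (nhds 0) := by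
      simpa using tendsto_one_div_atTop_nhds_zero_nat.mul_const (gainSum x (4 * a))
    exact (continuous_coe_real_ereal.tendsto 0).comp h1
  rw [← ht.liminf_eq]
  refine liminf_le_liminf ?_
  filter_upwards [eventually_ge_atTop (4 * a)] with m hm
  rw [EReal.coe_le_coe_iff]
  exact mul_le_mul_of_nonneg_left (hge m hm) (by positivity)

/-! ### Transition probabilities and the MDP itself. -/

/-- The probability of drawing `i` in a round with parameter `N`. -/
noncomputable def weight (N i : ℕ) : ENNReal := (ratio N : ENNReal) ^ i / total N

/-- The probability of being punished for naming `j` in a round with parameter `N`. -/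
noncomputable def risk (N j : ℕ) : ENNReal := ((ratio N : ENNReal) ^ (j + 1))⁻¹

lemma one_le_ratio_pow (N i : ℕ) : (1 : ENNReal) ≤ (ratio N : ENNReal) ^ i := by
  exact_mod_cast Nat.one_le_iff_ne_zero.2 (pow_pos (ratio_pos N) i).ne'

lemma ratio_pow_ne_top (N i : ℕ) : (ratio N : ENNReal) ^ i ≠ ⊤ := by
  exact_mod_cast ENNReal.natCast_ne_top (ratio N ^ i)

lemma ratio_pow_ne_zero (N i : ℕ) : (ratio N : ENNReal) ^ i ≠ 0 :=
  (zero_lt_one.trans_le (one_le_ratio_pow N i)).ne'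

lemma total_ne_zero (N : ℕ) : (total N : ENNReal) ≠ 0 := by
  exact_mod_cast (total_pos N).ne'

lemma risk_le_one (N j : ℕ) : risk N j ≤ 1 := by
  rw [risk, ENNReal.inv_le_one]; exact one_le_ratio_pow N _

lemma sum_weight (N : ℕ) : ∑ i ∈ Finset.range (N + 1), weight N i = 1 := by
  simp only [weight, div_eq_mul_inv]
  rw [← Finset.sum_mul]
  have : ∑ i ∈ Finset.range (N + 1), (ratio N : ENNReal) ^ i = total N := by
    simp [total]
  rw [this, ENNReal.mul_inv_cancel (total_ne_zero N) (ENNReal.natCast_ne_top _)]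

open Classical in
/-- The law of the number drawn in a round with parameter `N`. -/
noncomputable def draw (N : ℕ) : PMF ℕ :=
  PMF.ofFinset (fun i => if i ∈ Finset.range (N + 1) then weight N i else 0)
    (Finset.range (N + 1))
    (by rw [Finset.sum_congr rfl (fun i hi => if_pos hi), sum_weight])
    (fun i hi => if_neg hi)

/-- The law of the coin in a round with parameter `N` after naming `j`; `1` is unfavourable. -/
noncomputable def coin (N j : ℕ) : PMF ℕ :=
  PMF.ofFinset (fun i => if i = 1 then risk N j else if i = 0 then 1 - risk N j else 0)
    {0, 1}
    (by
      rw [Finset.sum_pair (by norm_num)]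
      simpa using tsub_add_cancel_of_le (risk_le_one N j))
    (fun i hi => by
      simp only [Finset.mem_insert, Finset.mem_singleton, not_or] at hi
      simp [hi])

lemma draw_apply {N i : ℕ} (hi : i ≤ N) : draw N i = weight N i :=
  if_pos (Finset.mem_range.2 (Nat.lt_succ_of_le hi))

lemma draw_apply_of_lt {N i : ℕ} (hi : N < i) : draw N i = 0 :=
  if_neg (fun h => by have := Finset.mem_range.1 h; omega)

lemma coin_one (N j : ℕ) : coin N j 1 = risk N j := rfl

lemma coin_zero (N j : ℕ) : coin N j 0 = 1 - risk N j := rfl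

/-- The law of the index after a random state with index `x` at time `t`. -/
noncomputable def indexLaw (t x : ℕ) : PMF ℕ :=
  if t % 4 = 0 then draw (param (t / 4))
  else if t % 4 = 3 then coin (param (t / 4)) x
  else PMF.pure 0

lemma indexLaw_zero (n x : ℕ) : indexLaw (4 * n) x = draw (param n) := by
  rw [indexLaw, if_pos (by omega), show 4 * n / 4 = n by omega]

lemma indexLaw_three (n x : ℕ) : indexLaw (4 * n + 3) x = coin (param n) x := by
  rw [indexLaw, if_neg (by omega), if_pos (by omega), show (4 * n + 3) / 4 = n by omega]

lemma le_bound_of_mem_support {t x i : ℕ} (hi : i ∈ (indexLaw t x).support) :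
    i ≤ bound (t + 1) := by
  rw [PMF.mem_support_iff] at hi
  unfold indexLaw at hi
  split_ifs at hi with h0 h3
  · obtain ⟨n, rfl⟩ : ∃ n, t = 4 * n := ⟨t / 4, by omega⟩
    rw [bound_one]
    by_contra hlt
    rw [show 4 * n / 4 = n by omega] at hi
    exact hi (draw_apply_of_lt (not_le.1 hlt))
  · obtain ⟨n, rfl⟩ : ∃ n, t = 4 * n + 3 := ⟨t / 4, by omega⟩
    rw [bound_zero]
    by_contra hlt
    refine hi ?_
    change (if i = 1 then _ else if i = 0 then _ else (0 : ENNReal)) = 0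
    rw [if_neg (by omega), if_neg (by omega)]
  · have : i = 0 := by
      by_contra hne
      exact hi (PMF.pure_apply_of_ne _ _ hne)
    omega

/-- The guessing MDP. The states are pairs of a time and an index. -/
noncomputable def mdp : MDP (ℕ × ℕ) where
  controlled := {s | s.1 % 4 = 2}
  trans s s' := s'.1 = s.1 + 1 ∧ s'.2 ≤ bound (s.1 + 1)
  exists_succ s := ⟨(s.1 + 1, 0), rfl, Nat.zero_le _⟩
  prob s _ := (indexLaw s.1 s.2).map (Prod.mk (s.1 + 1))
  prob_support s _ s' h := by
    rw [PMF.support_map] at h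
    obtain ⟨i, hi, rfl⟩ := h
    exact ⟨rfl, le_bound_of_mem_support hi⟩
  reward _ s' := gain s'.1 s'.2

lemma mdp_finitelyBranching : mdp.FinitelyBranching := by
  intro s
  refine Set.Finite.subset ((Set.finite_singleton (s.1 + 1)).prod
    (Set.finite_Iic (bound (s.1 + 1)))) ?_
  rintro s' ⟨h1, h2⟩
  exact ⟨h1, h2⟩

lemma mdp_acyclic : mdp.Acyclic := by
  have : ∀ s s', Relation.TransGen mdp.trans s s' → s.1 < s'.1 := by
    intro s s' h
    induction h with
    | single h => exact (Nat.lt_succ_self _).trans_eq h.1.symm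
    | tail _ h ih => exact ih.trans ((Nat.lt_succ_self _).trans_eq h.1.symm)
  exact fun s h => lt_irrefl _ (this s s h)

lemma mdp_stepCounterImplicit : mdp.StepCounterImplicit (0, 0) := by
  intro s
  refine ⟨s.1, ?_⟩
  rintro n ⟨p, h0, hn, hp⟩
  have : ∀ i ≤ n, (p i).1 = i := by
    intro i
    induction i with
    | zero => intro _; rw [h0]
    | succ i ih => intro hi; rw [(hp i hi).1, ih (by omega)]
  rw [← hn, this n le_rfl]

lemma mem_MP_iff {ρ : ℕ → ℕ × ℕ} (hρ : ∀ t, (ρ t).1 = t) :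
    ρ ∈ mdp.MP ↔ 0 ≤ liminf (fun n : ℕ =>
      ((1 / (n : ℝ) * gainSum (fun t => (ρ t).2) n : ℝ) : EReal)) atTop := by
  have : ∀ j, mdp.reward (ρ j) (ρ (j + 1)) = gain (j + 1) (ρ (j + 1)).2 := by
    intro j
    change gain (ρ (j + 1)).1 _ = _
    rw [hρ]
  simp only [MDP.MP, Set.mem_ofPred_eq, this, gainSum]

end Guess

/-! ### Failure probability of one round under bounded memory. -/

lemma PMF.tsum_mul_le_tsum_mul {α : Type*} (p : PMF α) {F G : α → ENNReal}
    (h : ∀ a ∈ p.support, F a ≤ G a) : ∑' a, p a * F a ≤ ∑' a, p a * G a := by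
  refine ENNReal.tsum_le_tsum fun a => ?_
  by_cases ha : p a = 0
  · simp [ha]
  · gcongr
    exact h a ha

lemma PMF.tsum_mul_le {α : Type*} (p : PMF α) {F : α → ENNReal} {c : ENNReal}
    (h : ∀ a ∈ p.support, F a ≤ c) : ∑' a, p a * F a ≤ c := by
  refine (p.tsum_mul_le_tsum_mul h).trans_eq ?_
  rw [ENNReal.tsum_mul_right, p.tsum_coe, one_mul]

lemma PMF.tsum_mul_add_const {α : Type*} (p : PMF α) (F : α → ENNReal) (c : ENNReal) :
    ∑' a, p a * (F a + c) = ∑' a, p a * F a + c := by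
  simp only [mul_add, ENNReal.tsum_add, ENNReal.tsum_mul_right, p.tsum_coe, one_mul]

namespace Guess

variable {Mem : Type*} (τ : mdp.MemoryUpdate Mem)

/-- A memory update may correlate the new mode with the random successor; functions of the state
alone see only the marginal, which the MDP fixes. -/
lemma tsum_next_random (m : Mem) {s : ℕ × ℕ} (hs : s.1 % 4 ≠ 2) (F : ℕ × ℕ → ENNReal) :
    ∑' y, τ.next (m, s) y * F y.2 = ∑' i, indexLaw s.1 s.2 i * F (s.1 + 1, i) := by
  rw [ENNReal.tsum_prod', ENNReal.tsum_comm, ← PMF.tsum_map_mul]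
  refine tsum_congr fun s' => ?_
  exact ENNReal.tsum_mul_right.trans (congrArg (· * F s') (τ.next_random m s hs s'))

/-- The inverse of the unnormalised weight. -/
noncomputable def scale (N i : ℕ) : ENNReal := ((ratio N : ENNReal) ^ i)⁻¹

lemma scale_le_one (N i : ℕ) : scale N i ≤ 1 := by
  rw [scale, ENNReal.inv_le_one]; exact one_le_ratio_pow N _

lemma weight_mul_scale (N i : ℕ) : weight N i * scale N i = (total N : ENNReal)⁻¹ := by
  rw [weight, scale, div_eq_mul_inv, mul_right_comm,
    ENNReal.mul_inv_cancel (ratio_pow_ne_zero N i) (ratio_pow_ne_top N i), one_mul]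

/-- The factor `scale` cancels the geometric weights, so all N+1 values count equally. -/
lemma tsum_draw_mul_scale_mul (N : ℕ) (F : ℕ → ENNReal) :
    ∑' i, draw N i * (scale N i * F i) =
      (total N : ENNReal)⁻¹ * ∑ i ∈ Finset.range (N + 1), F i := by
  rw [tsum_eq_sum (s := Finset.range (N + 1)), Finset.mul_sum]
  · refine Finset.sum_congr rfl fun i hi => ?_
    rw [draw_apply (Nat.lt_succ_iff.1 (Finset.mem_range.1 hi)), ← mul_assoc, weight_mul_scale]
  · intro i hi
    rw [draw_apply_of_lt (by simpa using hi), zero_mul]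

/-- The probability of not failing in a round with parameter `N`, having drawn `i` and
named `j`. -/
noncomputable def success (N i j : ℕ) : ENNReal := if j ≤ i then 1 - risk N j else 0

-- The balance behind the construction: a wrong name costs at least `scale N i`. For j < i the risk
-- exponent j+1 is at most i; for j > i failure is certain. It is written additively to avoid
-- truncated subtraction.
open Classical in
lemma success_add_scale_le (N i j : ℕ) :
    success N i j + scale N i ≤ (if j = i then scale N i else 0) + 1 := by
  rcases lt_trichotomy j i with h | h | h
  · rw [success, if_pos h.le, if_neg h.ne, zero_add]
    have : scale N i ≤ risk N j := by
      refine ENNReal.inv_le_inv.2 (pow_le_pow_right₀ ?_ h)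
      simpa using one_le_ratio_pow N 1
    calc 1 - risk N j + scale N i ≤ 1 - risk N j + risk N j := by gcongr
      _ = 1 := tsub_add_cancel_of_le (risk_le_one N j)
  · subst h
    rw [success, if_pos le_rfl, if_pos rfl, add_comm]
    gcongr
    exact tsub_le_self
  · rw [success, if_neg (not_le.2 h), if_neg h.ne', zero_add, zero_add]
    exact scale_le_one N i

lemma trans_iff {s s' : ℕ × ℕ} : mdp.trans s s' ↔ s'.1 = s.1 + 1 ∧ s'.2 ≤ bound (s.1 + 1) :=
  Iff.rfl

open Classical in
/-- The indicator of not failing, as a function of the elements of the chain. -/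
noncomputable def successInd (x y z : Mem × ℕ × ℕ) : ENNReal :=
  if x.2.2 < y.2.2 ∨ z.2.2 ≠ 0 then 0 else 1

lemma successInd_le_one (x y z : Mem × ℕ × ℕ) : successInd x y z ≤ 1 := by
  unfold successInd; split_ifs <;> simp

lemma tsum_successInd (n : ℕ) (x y : Mem × ℕ × ℕ) (hy : y.2.1 = 4 * n + 3) :
    ∑' z, τ.next y z * successInd x y z = success (param n) x.2.2 y.2.2 := by
  classical
  obtain ⟨m, t, j⟩ := y
  obtain rfl : t = 4 * n + 3 := hy
  refine (tsum_next_random τ m (s := (4 * n + 3, j)) (by change (4 * n + 3) % 4 ≠ 2; omega)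
    (fun s => if x.2.2 < j ∨ s.2 ≠ 0 then 0 else 1)).trans ?_
  rw [tsum_eq_single 0]
  · change indexLaw (4 * n + 3) j 0 * (if x.2.2 < j ∨ (0 : ℕ) ≠ 0 then 0 else 1) = _
    rw [indexLaw_three, coin_zero, success]
    by_cases h : j ≤ x.2.2
    · simp [h, not_lt.2 h]
    · simp [h, not_le.1 h]
  · intro i hi
    simp [hi]

open Classical in
/-- The probability of naming `i` in memory mode `m`. -/
noncomputable def nameProb (n : ℕ) (m : Mem) (i : ℕ) : ENNReal :=
  ∑' y, τ.next (m, (4 * n + 2, 0)) y * (if y.2.2 = i then 1 else 0)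

lemma sum_nameProb_le (n : ℕ) (m : Mem) (s : Finset ℕ) : ∑ i ∈ s, nameProb τ n m i ≤ 1 := by
  classical
  unfold nameProb
  rw [← Summable.tsum_finsetSum fun _ _ => ENNReal.summable]
  simp only [← Finset.mul_sum]
  refine PMF.tsum_mul_le _ fun y _ => ?_
  rw [Finset.sum_ite_eq]
  split_ifs <;> simp

lemma tsum_success_add_le (n i : ℕ) (m : Mem) :
    ∑' y, τ.next (m, (4 * n + 2, 0)) y * success (param n) i y.2.2 + scale (param n) i ≤
      scale (param n) i * nameProb τ n m i + 1 := by
  classical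
  rw [← PMF.tsum_mul_add_const, nameProb, ← ENNReal.tsum_mul_left]
  have : ∀ y, scale (param n) i * (τ.next (m, (4 * n + 2, 0)) y * (if y.2.2 = i then 1 else 0)) =
      τ.next (m, (4 * n + 2, 0)) y * (if y.2.2 = i then scale (param n) i else 0) := by
    intro y
    split_ifs <;> simp [mul_comm]
  simp only [this]
  rw [← PMF.tsum_mul_add_const]
  exact PMF.tsum_mul_le_tsum_mul _ fun y _ => success_add_scale_le _ _ _

/-- The probability of not failing in a round that starts in `x`. -/
noncomputable def roundSuccess (x : Mem × ℕ × ℕ) : ENNReal :=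
  ∑' x1, τ.next x x1 * ∑' x2, τ.next x1 x2 * ∑' x3, τ.next x2 x3 * ∑' x4, τ.next x3 x4 *
    successInd x1 x3 x4

lemma roundSuccess_le_one (x : Mem × ℕ × ℕ) : roundSuccess τ x ≤ 1 :=
  PMF.tsum_mul_le _ fun _ _ => PMF.tsum_mul_le _ fun _ _ => PMF.tsum_mul_le _ fun _ _ =>
    PMF.tsum_mul_le _ fun _ _ => successInd_le_one _ _ _

/-- With few memory modes, a round fails with some probability. -/
lemma roundSuccess_add_le {n : ℕ} {x : Mem × ℕ × ℕ} (hx : x.2.1 = 4 * n) {F : Finset Mem}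
    (hF : ∀ x1 ∈ (τ.next x).support, ∀ x2 ∈ (τ.next x1).support, x2.1 ∈ F) :
    roundSuccess τ x + (param n + 1 : ℕ) * (total (param n) : ENNReal)⁻¹ ≤
      F.card * (total (param n) : ENNReal)⁻¹ + 1 := by
  set N := param n with hN
  have hrand : ∀ f : ℕ → ENNReal, ∑' y, τ.next x y * f y.2.2 = ∑' i, draw N i * f i := by
    intro f
    obtain ⟨m, t, a⟩ := x
    obtain rfl : t = 4 * n := hx
    refine (tsum_next_random τ m (s := (4 * n, a)) (by change (4 * n) % 4 ≠ 2; omega)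
      (fun s => f s.2)).trans ?_
    rw [indexLaw_zero]
  have inner : ∀ x1 ∈ (τ.next x).support, (∑' x2, τ.next x1 x2 * ∑' x3, τ.next x2 x3 *
      ∑' x4, τ.next x3 x4 * successInd x1 x3 x4) + scale N x1.2.2 * 1 ≤
      scale N x1.2.2 * (∑ m ∈ F, nameProb τ n m x1.2.2) + 1 := by
    intro x1 h1
    rw [mul_one, ← PMF.tsum_mul_add_const]
    refine PMF.tsum_mul_le _ fun x2 h2 => ?_
    have t1 := τ.trans_of_mem_support h1
    have t2 := τ.trans_of_mem_support h2
    rw [trans_iff, hx] at t1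
    rw [trans_iff, t1.1] at t2
    obtain ⟨m2, t, i2⟩ := x2
    obtain rfl : t = 4 * n + 2 := t2.1
    obtain rfl : i2 = 0 := Nat.le_zero.1 (t2.2.trans_eq (bound_two n))
    have e : ∑' x3, τ.next (m2, (4 * n + 2, 0)) x3 * ∑' x4, τ.next x3 x4 * successInd x1 x3 x4 ≤
        ∑' x3, τ.next (m2, (4 * n + 2, 0)) x3 * success N x1.2.2 x3.2.2 := by
      refine PMF.tsum_mul_le_tsum_mul _ fun x3 h3 => ?_
      exact (tsum_successInd τ n x1 x3 (τ.trans_of_mem_support h3).1).le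
    calc _ ≤ _ := add_le_add_left e _
      _ ≤ _ := tsum_success_add_le τ n x1.2.2 m2
      _ ≤ _ := by
        gcongr
        -- The mode may depend on the drawn number, so its naming probability is bounded by the sum
        -- over all of `F`, which no longer involves the mode.
        exact Finset.single_le_sum (f := fun m => nameProb τ n m x1.2.2)
          (fun _ _ => zero_le) (hF x1 h1 _ h2)
  have outer := PMF.tsum_mul_le_tsum_mul (τ.next x) inner
  simp only [mul_add, ENNReal.tsum_add] at outer
  -- Average over the draw and exchange the sums over numbers and modes: each mode names the numbers
  -- with total probability at most 1.
  rw [hrand (fun i => scale N i * 1), hrand (fun i => scale N i * ∑ m ∈ F, nameProb τ n m i),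
    tsum_draw_mul_scale_mul, tsum_draw_mul_scale_mul, Finset.sum_comm] at outer
  simp only [mul_one, PMF.tsum_coe] at outer
  rw [Finset.sum_const, Finset.card_range, nsmul_one, mul_comm] at outer
  refine outer.trans ?_
  rw [mul_comm]
  gcongr
  calc _ ≤ ∑ m ∈ F, (1 : ENNReal) := Finset.sum_le_sum fun m _ => sum_nameProb_le τ n m _
    _ = F.card := by simp

/-- The rate at which a player with `K` memory modes fails in the round `n`. -/
noncomputable def failRate (K n : ℕ) : ℝ := ((param n + 1 - K : ℕ) : ℝ) / total (param n)

lemma failRate_nonneg (K n : ℕ) : 0 ≤ failRate K n := by unfold failRate; positivity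

lemma roundSuccess_le {n : ℕ} {x : Mem × ℕ × ℕ} (hx : x.2.1 = 4 * n) {F : Finset Mem} {K : ℕ}
    (hK : F.card ≤ K)
    (hF : ∀ x1 ∈ (τ.next x).support, ∀ x2 ∈ (τ.next x1).support, x2.1 ∈ F) :
    roundSuccess τ x ≤ ENNReal.ofReal (Real.exp (-failRate K n)) := by
  have h1 : roundSuccess τ x ≤ ENNReal.ofReal (1 - failRate K n) := by
    rw [ENNReal.ofReal_sub _ (failRate_nonneg K n), ENNReal.ofReal_one]
    have hZ : (0 : ℝ) < total (param n) := by exact_mod_cast total_pos _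
    have e : ENNReal.ofReal (failRate K n) =
        (param n + 1 - K : ℕ) * (total (param n) : ENNReal)⁻¹ := by
      rw [failRate, ENNReal.ofReal_div_of_pos hZ, ENNReal.ofReal_natCast, ENNReal.ofReal_natCast,
        div_eq_mul_inv]
    rw [e]
    -- With at least N+1 modes the truncated `failRate` is 0 and the bound is trivial.
    rcases le_total (param n + 1) K with h | h
    · rw [Nat.sub_eq_zero_of_le h]
      simpa using roundSuccess_le_one τ x
    · refine ENNReal.le_sub_of_add_le_right ?_ ?_
      · exact ENNReal.mul_ne_top (ENNReal.natCast_ne_top _)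
          (ENNReal.inv_ne_top.2 (total_ne_zero _))
      · have key := roundSuccess_add_le τ hx hF
        have hc : (K : ENNReal) * (total (param n) : ENNReal)⁻¹ ≠ ⊤ :=
          ENNReal.mul_ne_top (ENNReal.natCast_ne_top _) (ENNReal.inv_ne_top.2 (total_ne_zero _))
        refine (ENNReal.add_le_add_iff_right hc).1 ?_
        rw [add_assoc, ← add_mul, ← Nat.cast_add, Nat.sub_add_cancel h]
        refine key.trans ?_
        rw [add_comm]
        gcongr
  refine h1.trans (ENNReal.ofReal_le_ofReal ?_)
  linarith [Real.add_one_le_exp (-failRate K n)]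

/-- Grouping the `total N` rounds with parameter N gives N+1-K, which is at least 1 once N ≥ K and
so cannot tend to 0. -/
lemma not_summable_failRate (K : ℕ) : ¬ Summable (failRate K) := by
  intro h
  have h2 : Summable (fun s : Σ N, Fin (total N) =>
      ((s.1 + 1 - K : ℕ) : ℝ) / total s.1) := by
    rw [← roundEquiv.summable_iff]
    exact h
  have h3 := h2.sigma
  have e : ∀ N, ∑' _i : Fin (total N), ((N + 1 - K : ℕ) : ℝ) / total N = (N + 1 - K : ℕ) := by
    intro N
    have : (total N : ℝ) ≠ 0 := by exact_mod_cast (total_pos N).ne'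
    rw [tsum_fintype, Finset.sum_const, Finset.card_univ, Fintype.card_fin, nsmul_eq_mul]
    field_simp
  simp only [e] at h3
  have h4 := h3.tendsto_atTop_zero.eventually (gt_mem_nhds (zero_lt_one' ℝ))
  obtain ⟨N, hN, hK⟩ := (h4.and (eventually_ge_atTop K)).exists
  have : 1 ≤ N + 1 - K := by omega
  exact absurd hN (not_lt.2 (by exact_mod_cast this))

end Guess

/-! ### Bounded memory fails infinitely often, almost surely. -/

namespace Guess

lemma measurableSet_fails (n : ℕ) : MeasurableSet {x : ℕ → ℕ | Fails x n} :=
  (measurableSet_lt (measurable_pi_apply (4 * n + 1)) (measurable_pi_apply (4 * n + 3))).union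
    (measurable_pi_apply (4 * n + 4) (MeasurableSet.of_discrete (s := {0}ᶜ)))

/-- No failure in the rounds from `a` on, before the round `b`. -/
def NoFail (a b : ℕ) : Set (ℕ → ℕ) := {x | ∀ l, a ≤ l → l < b → ¬ Fails x l}

lemma measurableSet_noFail (a b : ℕ) : MeasurableSet (NoFail a b) := by
  have : NoFail a b = ⋂ l, ⋂ (_ : a ≤ l), ⋂ (_ : l < b), {x | Fails x l}ᶜ := by
    ext x; simp [NoFail]
  rw [this]
  exact MeasurableSet.iInter fun l => MeasurableSet.iInter fun _ => MeasurableSet.iInter fun _ =>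
    (measurableSet_fails l).compl

lemma runMeasure_ae (σ : mdp.Strategy) : ∀ᵐ ρ ∂mdp.runMeasure (0, 0) σ,
    (∀ t, (ρ t).1 = t) ∧ ∀ t, (ρ (t + 1)).2 ≤ bound (t + 1) := by
  filter_upwards [pathMeasure_ae_zero σ.next (0, 0),
    pathMeasure_ae_succ σ.next (0, 0) (fun _ h s => mdp.trans h.last s)
      (fun n h s hs => σ.trans_of_mem_support hs)] with ρ h0 h1
  have h2 : ∀ t, mdp.trans (ρ t) (ρ (t + 1)) := h1
  have h3 : ∀ t, (ρ t).1 = t := by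
    intro t
    induction t with
    | zero => rw [h0]
    | succ t ih => rw [(h2 t).1, ih]
  refine ⟨h3, fun t => ?_⟩
  have := (h2 t).2
  rwa [h3] at this

/-- The indices of the states of a trajectory of the chain. -/
def indices {Mem : Type*} (w : ℕ → Mem × ℕ × ℕ) : ℕ → ℕ := fun t => (w t).2.2

lemma measurable_indices {Mem : Type*} [MeasurableSpace Mem] :
    Measurable (indices : (ℕ → Mem × ℕ × ℕ) → ℕ → ℕ) :=
  measurable_pi_lambda _ fun t =>
    measurable_snd.comp (measurable_snd.comp (measurable_pi_apply t))

variable {Mem : Type*} [Countable Mem] [MeasurableSpace Mem] [DiscreteMeasurableSpace Mem]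
  (τ : mdp.MemoryUpdate Mem)

lemma chain_ae (m₀ : Mem) : ∀ᵐ w ∂τ.chain m₀ (0, 0), ∀ t, (w t).2.1 = t := by
  filter_upwards [pathMeasure_ae_zero (fun _ h => τ.next h.last) (m₀, ((0, 0) : ℕ × ℕ)),
    pathMeasure_ae_succ (fun _ h => τ.next h.last) (m₀, ((0, 0) : ℕ × ℕ))
      (fun _ h s => mdp.trans h.last.2 s.2)
      (fun n h s hs => τ.trans_of_mem_support hs)] with w h0 h1
  have h2 : ∀ t, mdp.trans (w t).2 (w (t + 1)).2 := h1
  intro t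
  induction t with
  | zero => rw [h0]
  | succ t ih => rw [(h2 t).1, ih]

/-- The bound on `roundSuccess` holds for every starting mode and state at time 4b, so it factors
out after conditioning on the past. -/
lemma measure_noFail_succ_le (m₀ : Mem) {K : ℕ}
    (hK : ∀ x, ∃ F : Finset Mem, F.card ≤ K ∧
      ∀ x1 ∈ (τ.next x).support, ∀ x2 ∈ (τ.next x1).support, x2.1 ∈ F)
    {a b : ℕ} (hab : a ≤ b) :
    τ.chain m₀ (0, 0) (indices ⁻¹' NoFail a (b + 1)) ≤
      τ.chain m₀ (0, 0) (indices ⁻¹' NoFail a b) *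
        ENNReal.ofReal (Real.exp (-failRate K b)) := by
  classical
  have hm : ∀ c, MeasurableSet (indices ⁻¹' NoFail a c : Set (ℕ → Mem × ℕ × ℕ)) := fun c =>
    measurable_indices (measurableSet_noFail a c)
  -- Rounds before b end by time 4b, so the filler beyond the history does not affect the event.
  let A : Hist (Mem × ℕ × ℕ) (4 * b) → ENNReal := fun h =>
    (indices ⁻¹' NoFail a b).indicator 1
      (fun i => if hi : i ≤ 4 * b then h ⟨i, Finset.mem_Iic.2 hi⟩ else Hist.last h)
  have hA : ∀ w, A (Hist.of (4 * b) w) = (indices ⁻¹' NoFail a b).indicator 1 w := by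
    intro w
    have : ∀ l, l < b → (Fails (indices fun i => if hi : i ≤ 4 * b then
        Hist.of (4 * b) w ⟨i, Finset.mem_Iic.2 hi⟩ else Hist.last (Hist.of (4 * b) w)) l ↔
        Fails (indices w) l) := by
      intro l hl
      simp only [Fails, indices, dif_pos (show 4 * l + 1 ≤ 4 * b by omega),
        dif_pos (show 4 * l + 3 ≤ 4 * b by omega), dif_pos (show 4 * l + 4 ≤ 4 * b by omega)]
    have e : ((fun i => if hi : i ≤ 4 * b then Hist.of (4 * b) w ⟨i, Finset.mem_Iic.2 hi⟩
        else Hist.last (Hist.of (4 * b) w)) ∈ indices ⁻¹' NoFail a b) ↔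
        w ∈ indices ⁻¹' NoFail a b := by
      constructor
      · exact fun h l h1 h2 h3 => h l h1 h2 ((this l h2).2 h3)
      · exact fun h l h1 h2 h3 => h l h1 h2 ((this l h2).1 h3)
    simp only [A, Set.indicator, e, Pi.one_apply]
  have e1 : ∀ w : ℕ → Mem × ℕ × ℕ, (indices ⁻¹' NoFail a (b + 1)).indicator 1 w =
      A (Hist.of (4 * b) w) * successInd (w (4 * b + 1)) (w (4 * b + 3)) (w (4 * b + 4)) := by
    intro w
    have hs : successInd (w (4 * b + 1)) (w (4 * b + 3)) (w (4 * b + 4)) =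
        if Fails (indices w) b then 0 else 1 := by
      by_cases h : Fails (indices w) b
      · exact (if_pos h).trans (if_pos h).symm
      · exact (if_neg h).trans (if_neg h).symm
    rw [hA, hs]
    have : w ∈ indices ⁻¹' NoFail a (b + 1) ↔
        w ∈ indices ⁻¹' NoFail a b ∧ ¬ Fails (indices w) b := by
      constructor
      · exact fun h => ⟨fun l h1 h2 => h l h1 (by omega), h b hab (by omega)⟩
      · rintro ⟨h, hb⟩ l h1 h2
        rcases Nat.lt_succ_iff_lt_or_eq.1 h2 with h3 | rfl
        · exact h l h1 h3
        · exact hb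
    simp only [Set.indicator, this, Pi.one_apply]
    by_cases h1 : w ∈ indices ⁻¹' NoFail a b <;> by_cases h2 : Fails (indices w) b <;>
      simp [h1, h2]
  rw [← lintegral_indicator_one (hm _), lintegral_congr e1]
  refine (lintegral_chain_four τ.next (m₀, ((0, 0) : ℕ × ℕ)) (4 * b) A
    (fun _ x _ y z => successInd x y z)).trans_le ?_
  calc _ ≤ ∫⁻ w, (indices ⁻¹' NoFail a b).indicator 1 w *
        ENNReal.ofReal (Real.exp (-failRate K b)) ∂τ.chain m₀ (0, 0) := by
        refine lintegral_mono_ae ?_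
        filter_upwards [chain_ae τ m₀] with w hw
        rw [hA]
        obtain ⟨F, hF, hF2⟩ := hK (w (4 * b))
        gcongr
        exact roundSuccess_le τ (hw _) hF hF2
    _ = _ := by
        rw [lintegral_mul_const _ (measurable_one.indicator (hm b)),
          lintegral_indicator_one (hm b)]

lemma measure_noFail_le (m₀ : Mem) {K : ℕ}
    (hK : ∀ x, ∃ F : Finset Mem, F.card ≤ K ∧
      ∀ x1 ∈ (τ.next x).support, ∀ x2 ∈ (τ.next x1).support, x2.1 ∈ F) (a m : ℕ) :
    τ.chain m₀ (0, 0) (indices ⁻¹' NoFail a (a + m)) ≤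
      ENNReal.ofReal (Real.exp (-∑ l ∈ Finset.range m, failRate K (l + a))) := by
  induction m with
  | zero =>
    have : IsProbabilityMeasure (τ.chain m₀ ((0, 0) : ℕ × ℕ)) :=
      pathMeasure.instIsProbabilityMeasure _ _
    simpa using prob_le_one
  | succ m ih =>
    refine (measure_noFail_succ_le τ m₀ hK (Nat.le_add_right a m)).trans ?_
    rw [Finset.sum_range_succ, neg_add, Real.exp_add, ENNReal.ofReal_mul (Real.exp_pos _).le,
      add_comm m a]
    gcongr

/-- Memory that takes boundedly many values at any given time is useless. -/
theorem runMeasure_MP_eq_zero {σ : mdp.Strategy} {m₀ : Mem} (hσ : τ.Implements m₀ (0, 0) σ)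
    {K : ℕ} (hK : ∀ x, ∃ F : Finset Mem, F.card ≤ K ∧
      ∀ x1 ∈ (τ.next x).support, ∀ x2 ∈ (τ.next x1).support, x2.1 ∈ F) :
    mdp.runMeasure (0, 0) σ mdp.MP = 0 := by
  have hnull : ∀ a, τ.chain m₀ (0, 0) (⋂ m, indices ⁻¹' NoFail a (a + m)) = 0 := by
    intro a
    have hsum : Tendsto (fun m => ∑ l ∈ Finset.range m, failRate K (l + a)) atTop atTop :=
      (not_summable_iff_tendsto_nat_atTop_of_nonneg fun l => failRate_nonneg K (l + a)).1
        (fun h => not_summable_failRate K ((summable_nat_add_iff a).1 h))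
    have hlim : Tendsto (fun m => ENNReal.ofReal
        (Real.exp (-∑ l ∈ Finset.range m, failRate K (l + a)))) atTop (nhds 0) := by
      rw [← ENNReal.ofReal_zero]
      exact ENNReal.tendsto_ofReal (Real.tendsto_exp_neg_atTop_nhds_zero.comp hsum)
    refine le_antisymm (ge_of_tendsto' hlim fun m => ?_) zero_le
    exact (measure_mono (Set.iInter_subset _ m)).trans (measure_noFail_le τ m₀ hK a m)
  have hproj : Measurable (fun (w : ℕ → Mem × ℕ × ℕ) n => (w n).2) :=
    measurable_pi_lambda _ fun n => measurable_snd.comp (measurable_pi_apply n)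
  have hind : Measurable (fun (ρ : ℕ → ℕ × ℕ) n => (ρ n).2) :=
    measurable_pi_lambda _ fun n => measurable_snd.comp (measurable_pi_apply n)
  have hfreq : ∀ᵐ ρ ∂mdp.runMeasure (0, 0) σ, ∀ a, ∃ m, (fun n => (ρ n).2) ∉ NoFail a (a + m) := by
    rw [ae_all_iff]
    intro a
    have hms : MeasurableSet (⋂ m, (fun (ρ : ℕ → ℕ × ℕ) n => (ρ n).2) ⁻¹' NoFail a (a + m)) :=
      MeasurableSet.iInter fun m => hind (measurableSet_noFail _ _)
    have h0 : mdp.runMeasure (0, 0) σ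
        (⋂ m, (fun (ρ : ℕ → ℕ × ℕ) n => (ρ n).2) ⁻¹' NoFail a (a + m)) = 0 := by
      rw [hσ.runMeasure_eq, Measure.map_apply hproj hms, Set.preimage_iInter]
      exact hnull a
    refine measure_mono_null ?_ h0
    intro ρ hρ
    simpa using hρ
  have hae : ∀ᵐ ρ ∂mdp.runMeasure (0, 0) σ, ρ ∉ mdp.MP := by
    filter_upwards [hfreq, runMeasure_ae σ] with ρ h1 h2
    rw [mem_MP_iff h2.1, not_le]
    refine liminf_lt_zero_of_frequently_fails h2.2 ?_
    rw [frequently_atTop]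
    intro a
    obtain ⟨m, hm⟩ := h1 a
    simp only [NoFail, Set.mem_ofPred_eq, not_forall, not_not] at hm
    obtain ⟨l, hl, _, hf⟩ := hm
    exact ⟨l, hl, hf⟩
  simpa [ae_iff] using hae

lemma runMeasure_MP_of_isFR {σ : mdp.Strategy} (hσ : mdp.IsFR (0, 0) σ) :
    mdp.runMeasure (0, 0) σ mdp.MP = 0 := by
  obtain ⟨Mem, _, _, _, τ, m₀, h⟩ := hσ
  have := Fintype.ofFinite Mem
  exact runMeasure_MP_eq_zero τ h (K := Fintype.card Mem)
    fun x => ⟨Finset.univ, le_rfl, fun _ _ _ _ => Finset.mem_univ _⟩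

lemma runMeasure_MP_of_isKBitMarkov {σ : mdp.Strategy} {k : ℕ}
    (hσ : mdp.IsKBitMarkov (0, 0) k σ) : mdp.runMeasure (0, 0) σ mdp.MP = 0 := by
  obtain ⟨τ, b₀, hτ, h⟩ := hσ
  refine runMeasure_MP_eq_zero τ h (K := Fintype.card (Fin k → Bool)) fun x =>
    -- The name is chosen two steps after the round starts; by then the counter has a single
    -- possible value and only the 2^k bit patterns remain.
    ⟨{x.1.1 + 1 + 1} ×ˢ Finset.univ, by simp, fun x1 h1 x2 h2 => ?_⟩
  rw [Finset.mem_product, Finset.mem_singleton]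
  exact ⟨(hτ x1.1 x1.2 x2 h2).trans (congrArg (· + 1) (hτ x.1 x.2 x1 h1)), Finset.mem_univ _⟩

end Guess

/-! ### Remembering the drawn number wins almost surely. -/

namespace Guess

/-- The strategy that names the number drawn. -/
noncomputable def honest : mdp.Strategy where
  act n h _ := PMF.pure (h.last.1 + 1,
    min (h ⟨n - 1, Finset.mem_Iic.2 (Nat.sub_le n 1)⟩).2 (bound (h.last.1 + 1)))
  act_support n h _ s' hs := by
    rw [PMF.support_pure, Set.mem_singleton_iff] at hs
    subst hs
    exact ⟨rfl, min_le_right _ _⟩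

lemma honest_ae : ∀ᵐ ρ ∂mdp.runMeasure (0, 0) honest,
    ∀ n, (ρ (4 * n + 3)).2 = (ρ (4 * n + 1)).2 := by
  have h := pathMeasure_ae_succ honest.next (0, 0)
    (fun n h s => h.last.1 = n → n % 4 = 2 →
      s.2 = min (h ⟨n - 1, Finset.mem_Iic.2 (Nat.sub_le n 1)⟩).2 (bound (n + 1)))
    (by
      intro n h s hs h1 h2
      have hc : h.last ∈ mdp.controlled := by
        change h.last.1 % 4 = 2
        rw [h1, h2]
      rw [MDP.Strategy.next, dif_pos hc] at hs
      have := (PMF.mem_support_pure_iff _ _).1 hs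
      rw [this, h1])
  filter_upwards [h, runMeasure_ae honest] with ρ h1 h2 n
  have h3 : (ρ (4 * n + 2 + 1)).2 = min (ρ (4 * n + 1)).2 (bound (4 * n + 2 + 1)) :=
    h1 (4 * n + 2) (h2.1 _) (by omega)
  have h4 := h2.2 (4 * n)
  rw [bound_one] at h4
  rw [h3, bound_three, min_eq_left h4]

lemma next_random (σ : mdp.Strategy) {n : ℕ} (h : Hist (ℕ × ℕ) n) (hn : h.last.1 % 4 ≠ 2)
    (F : ℕ × ℕ → ENNReal) :
    ∑' s, σ.next n h s * F s = ∑' i, indexLaw h.last.1 h.last.2 i * F (h.last.1 + 1, i) := by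
  rw [MDP.Strategy.next, dif_neg (show h.last ∉ mdp.controlled from hn)]
  exact PMF.tsum_map_mul _ _ _

lemma measurable_index (t : ℕ) : Measurable (fun ρ : ℕ → ℕ × ℕ => (ρ t).2) :=
  measurable_snd.comp (measurable_pi_apply t)

lemma lintegral_draw (σ : mdp.Strategy) (n : ℕ) (F : ℕ → ENNReal) :
    ∫⁻ ρ, F (ρ (4 * n + 1)).2 ∂mdp.runMeasure (0, 0) σ = ∑' i, draw (param n) i * F i := by
  have : IsProbabilityMeasure (mdp.runMeasure (0, 0) σ) :=
    pathMeasure.instIsProbabilityMeasure _ _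
  have h := lintegral_pathMeasure_succ σ.next (0, 0) (4 * n) (fun _ s => F s.2)
  refine h.trans ?_
  have e : ∀ᵐ ρ ∂mdp.runMeasure (0, 0) σ,
      ∑' s, σ.next (4 * n) (Hist.of (4 * n) ρ) s * F s.2 = ∑' i, draw (param n) i * F i := by
    filter_upwards [runMeasure_ae σ] with ρ hρ
    have hl : (Hist.of (4 * n) ρ).last.1 = 4 * n := hρ.1 _
    rw [next_random σ _ (by rw [hl]; omega) (fun s => F s.2), hl, indexLaw_zero]
  refine (lintegral_congr_ae e).trans ?_
  rw [lintegral_const, measure_univ, mul_one]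

lemma measure_punished (σ : mdp.Strategy) (n : ℕ) :
    mdp.runMeasure (0, 0) σ {ρ | (ρ (4 * n + 4)).2 ≠ 0} =
      ∫⁻ ρ, risk (param n) (ρ (4 * n + 3)).2 ∂mdp.runMeasure (0, 0) σ := by
  classical
  have hm : MeasurableSet {ρ : ℕ → ℕ × ℕ | (ρ (4 * n + 4)).2 ≠ 0} :=
    measurable_index _ (MeasurableSet.of_discrete (s := {0}ᶜ))
  have h := lintegral_pathMeasure_succ σ.next (0, 0) (4 * n + 3)
    (fun _ s => if s.2 ≠ 0 then 1 else 0)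
  rw [← lintegral_indicator_one hm]
  refine Eq.trans ?_ (h.trans ?_)
  · refine lintegral_congr fun ρ => ?_
    simp [Set.indicator]
  · refine lintegral_congr_ae ?_
    filter_upwards [runMeasure_ae σ] with ρ hρ
    have hl : (Hist.of (4 * n + 3) ρ).last.1 = 4 * n + 3 := hρ.1 _
    rw [next_random σ _ (by rw [hl]; omega) (fun s => if s.2 ≠ 0 then 1 else 0), hl,
      indexLaw_three, tsum_eq_single 1]
    · rw [coin_one]
      simp [Hist.last]
    · intro i hi
      by_cases h0 : i = 0
      · simp [h0]
      · have : coin (param n) (Hist.of (4 * n + 3) ρ).last.2 i = 0 := by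
          change (if i = 1 then _ else if i = 0 then _ else (0 : ENNReal)) = 0
          rw [if_neg hi, if_neg h0]
        rw [this, zero_mul]

lemma measure_honest_punished (n : ℕ) :
    mdp.runMeasure (0, 0) honest {ρ | (ρ (4 * n + 4)).2 ≠ 0} =
      (total (param n) : ENNReal)⁻¹ * ((param n + 1 : ℕ) * (ratio (param n) : ENNReal)⁻¹) := by
  rw [measure_punished]
  have e : ∀ᵐ ρ ∂mdp.runMeasure (0, 0) honest, risk (param n) (ρ (4 * n + 3)).2 =
      scale (param n) (ρ (4 * n + 1)).2 * (ratio (param n) : ENNReal)⁻¹ := by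
    filter_upwards [honest_ae] with ρ hρ
    rw [hρ, risk, scale, pow_succ, ENNReal.mul_inv (Or.inl (ratio_pow_ne_zero _ _))
      (Or.inl (ratio_pow_ne_top _ _))]
  rw [lintegral_congr_ae e,
    lintegral_draw honest n (fun i => scale (param n) i * (ratio (param n) : ENNReal)⁻¹),
    tsum_draw_mul_scale_mul, Finset.sum_const, Finset.card_range, nsmul_eq_mul]

/-- The `total N` rounds with parameter N contribute (N+1)/4^N ≤ 2^(-N), using N+1 ≤ 2^N. -/
lemma tsum_punished_ne_top :
    ∑' n, mdp.runMeasure (0, 0) honest {ρ | (ρ (4 * n + 4)).2 ≠ 0} ≠ ⊤ := by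
  have e : ∑' n, mdp.runMeasure (0, 0) honest {ρ | (ρ (4 * n + 4)).2 ≠ 0} =
      ∑' s : Σ N, Fin (total N),
        (total s.1 : ENNReal)⁻¹ * ((s.1 + 1 : ℕ) * (ratio s.1 : ENNReal)⁻¹) := by
    rw [← roundEquiv.tsum_eq]
    exact tsum_congr measure_honest_punished
  rw [e, ENNReal.tsum_sigma']
  have e2 : ∀ N : ℕ, ∑' _i : Fin (total N),
      (total N : ENNReal)⁻¹ * ((N + 1 : ℕ) * (ratio N : ENNReal)⁻¹) ≤ 2⁻¹ ^ N := by
    intro N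
    rw [tsum_fintype, Finset.sum_const, Finset.card_univ, Fintype.card_fin, nsmul_eq_mul,
      ← mul_assoc, ENNReal.mul_inv_cancel (total_ne_zero N) (ENNReal.natCast_ne_top _), one_mul,
      ← div_eq_mul_inv]
    refine ENNReal.div_le_of_le_mul ?_
    have h1 : (N + 1 : ℕ) ≤ 2 ^ N := Nat.lt_two_pow_self
    have h2 : (ratio N : ENNReal) = 2 ^ N * 2 ^ N := by
      rw [ratio, ← mul_pow]; norm_num
    rw [h2, ← mul_assoc, ← mul_pow, ENNReal.inv_mul_cancel (by norm_num) (by norm_num), one_pow,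
      one_mul]
    exact_mod_cast h1
  refine ne_top_of_le_ne_top ?_ (ENNReal.tsum_le_tsum e2)
  rw [ENNReal.tsum_geometric]
  simp

lemma honest_mem_MP : ∀ᵐ ρ ∂mdp.runMeasure (0, 0) honest, ρ ∈ mdp.MP := by
  filter_upwards [ae_eventually_notMem tsum_punished_ne_top, honest_ae, runMeasure_ae honest]
    with ρ h1 h2 h3
  rw [mem_MP_iff h3.1]
  refine zero_le_liminf h2 ?_
  filter_upwards [h1] with n hn
  simpa using hn

lemma value_eq_one : mdp.value mdp.MP (0, 0) = 1 := by
  have hp : ∀ σ : mdp.Strategy, IsProbabilityMeasure (mdp.runMeasure (0, 0) σ) := fun σ =>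
    pathMeasure.instIsProbabilityMeasure _ _
  refine le_antisymm (iSup_le fun σ => prob_le_one) ?_
  refine le_iSup_of_le honest ?_
  exact ((measure_congr (eventuallyEq_univ.2 honest_mem_MP)).trans measure_univ).ge

end Guess

/-! ### Assembly of the theorem. -/

theorem mainTheorem4 :
    ∃ (S : Type) (_ : Countable S) (_ : MeasurableSpace S) (_ : DiscreteMeasurableSpace S)
      (M : MDP S) (s₀ : S),
      M.FinitelyBranching ∧ M.Acyclic ∧ M.StepCounterImplicit s₀ ∧
      M.value M.MP s₀ = 1 ∧
      (∀ σ : M.Strategy, M.IsFR s₀ σ → M.runMeasure s₀ σ M.MP = 0) ∧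
      (∀ (k : ℕ) (ε : ℝ), ε < 1 →
        ¬ ∃ σ : M.Strategy, M.IsKBitMarkov s₀ k σ ∧ M.IsEpsOptimal M.MP s₀ ε σ) := by
  refine ⟨ℕ × ℕ, inferInstance, inferInstance, inferInstance, Guess.mdp, (0, 0),
    Guess.mdp_finitelyBranching, Guess.mdp_acyclic, Guess.mdp_stepCounterImplicit,
    Guess.value_eq_one, fun σ => Guess.runMeasure_MP_of_isFR, ?_⟩
  rintro k ε hε ⟨σ, hσ, hopt⟩
  rw [MDP.IsEpsOptimal, Guess.value_eq_one, Guess.runMeasure_MP_of_isKBitMarkov hσ] at hopt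
  norm_num at hopt
  linarith
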